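/- Let $\Omega\subset\mathbb{R}^d$, $d\in\{2,3\}$, be a polygonal/polyhedral domain: open, connected, non-empty, with $\bar\Omega$ a finite union of non-degenerate $d$-simplices and $\Omega=\operatorname{int}\bar\Omega$. Let $\partial\Omega=\bar\Gamma_{\rm D}\cup\bar\Gamma_{\rm N}$ with $\Gamma_{\rm D},\Gamma_{\rm N}\subset\partial\Omega$ disjoint and $\Gamma_{\rm D}\neq\emptyset$, where $\partial\Omega\setminus(\Gamma_{\rm D}\cup\Gamma_{\rm N})$ and $\bar\Gamma_{\rm D}\cap\bar\Gamma_{\rm N}$ have zero surface measure. Let $\nu\in L^\infty(\Omega)$ be bounded below by a positive constant (for instance positive and piecewise constant), $f,f^O\in L^2(\Omega)$, $g_{\rm N},g^O_{\rm N}\in L^2(\Gamma_{\rm N})$, $g_{\rm D},g^O_{\rm D}\in C(\Gamma_{\rm D})$. Write $(\cdot,\cdot)$ for the $L^2(\Omega)$ inner product (of functions or fields), $\boldsymbol n$ for the outward unit normal, $\|\boldsymbol v\|=(\nu^{-1}\boldsymbol v,\boldsymbol v)^{1/2}$ for the energy norm, $\mathcal W=H^1(\Omega)$, and $\mathcal V$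 for the set of fields $\boldsymbol v\in H(\mathrm{div};\Omega)$ whose normal trace on $\Gamma_{\rm N}$ is in $L^2(\Gamma_{\rm N})$, that is, for which there is a function $\boldsymbol v\cdot\boldsymbol n\in L^2(\Gamma_{\rm N})$ with $(\boldsymbol v,\nabla w)+(\nabla\cdot\boldsymbol v,w)=\langle\boldsymbol v\cdot\boldsymbol n,w\rangle_{\Gamma_{\rm N}}:=\int_{\Gamma_{\rm N}}(\boldsymbol v\cdot\boldsymbol n)\,w$ for all $w\in\mathcal W$ with $w=0$ on $\Gamma_{\rm D}$. For $\boldsymbol v\in\mathcal V$ and $w\in\mathcal W$ put $\langle\boldsymbol v\cdot\boldsymbol n,w\rangle_{\Gamma_{\rm D}}:=(\boldsymbol v,\nabla w)+(\nabla\cdot\boldsymbol v,w)-\langle\boldsymbol v\cdot\boldsymbol n,w\rangle_{\Gamma_{\rm N}}$, which depends only on $\boldsymbol v$ and the trace of $w$ on $\Gamma_{\rm D}$; for a function $g$ on $\Gamma_{\rm D}$ that is the trace of some $w\in\mathcal W$, $\langle g,\boldsymbol v\cdot\boldsymbol n\rangle_{\Gamma_{\rm D}}$ denotes this value. All boundary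 values are meant in the sense of traces. Let $(u,\boldsymbol q)\in\mathcal W\times\mathcal V$ be a weak solution of the mixed Poisson problem $\boldsymbol q=-\nu\nabla u$ and $\nabla\cdot\boldsymbol q=f$ in $\Omega$, $u=g_{\rm D}$ on $\Gamma_{\rm D}$, $\boldsymbol q\cdot\boldsymbol n=g_{\rm N}$ on $\Gamma_{\rm N}$, that is, for all $(w,\boldsymbol v)\in\mathcal W\times\mathcal V$, $$(\nu^{-1}\boldsymbol q,\boldsymbol v)-(u,\nabla\cdot\boldsymbol v)+\langle u,\boldsymbol v\cdot\boldsymbol n\rangle_{\Gamma_{\rm N}}-(\boldsymbol q,\nabla w)+\langle\boldsymbol q\cdot\boldsymbol n,w\rangle_{\Gamma_{\rm D}}=(f,w)-\langle g_{\rm D},\boldsymbol v\cdot\boldsymbol n\rangle_{\Gamma_{\rm D}}-\langle g_{\rm N},w\rangle_{\Gamma_{\rm N}},$$ and let $s=\ell^O(u,\boldsymbol q)$, where $\ell^O(w,\boldsymbol v)=(f^O,w)+\langle g^O_{\rm D},\boldsymbol v\cdot\boldsymbol n\rangle_{\Gamma_{\rm D}}+\langle g^O_{\rm N},w\rangle_{\Gamma_{\rm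 N}}$. Let $(\tilde u_h,\tilde{\boldsymbol q}_h),(\tilde\xi_h,\tilde{\boldsymbol\zeta}_h)\in\mathcal W\times\mathcal V$ be potential and equilibrated flux reconstructions of the primal and of the adjoint problem: $$\tilde u_h=g_{\rm D}\text{ on }\Gamma_{\rm D},\quad \nabla\cdot\tilde{\boldsymbol q}_h=f\text{ in }\Omega,\quad \tilde{\boldsymbol q}_h\cdot\boldsymbol n=g_{\rm N}\text{ on }\Gamma_{\rm N},$$ $$\tilde\xi_h=g^O_{\rm D}\text{ on }\Gamma_{\rm D},\quad \nabla\cdot\tilde{\boldsymbol\zeta}_h=f^O\text{ in }\Omega,\quad \tilde{\boldsymbol\zeta}_h\cdot\boldsymbol n=-g^O_{\rm N}\text{ on }\Gamma_{\rm N}.$$ Define $$s_h^{\pm}=\ell^O(\tilde u_h,\tilde{\boldsymbol q}_h)+\tfrac12\big(\nu^{-1}(\tilde{\boldsymbol q}_h+\nu\nabla\tilde u_h),\tilde{\boldsymbol\zeta}_h-\nu\nabla\tilde\xi_h\big)\pm\tfrac12\|\tilde{\boldsymbol q}_h+\nu\nabla\tilde u_h\|\,\|\tilde{\boldsymbol\zeta}_h+\nu\nabla\tilde\xi_h\|,$$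 $\tilde s_h=\tfrac12(s_h^++s_h^-)$ and $\Delta_h=s_h^+-s_h^-$. Then $s_h^-\le s\le s_h^+$, where $$\tilde s_h=\ell^O(\tilde u_h,\tilde{\boldsymbol q}_h)+\tfrac12\big(\nu^{-1}(\tilde{\boldsymbol q}_h+\nu\nabla\tilde u_h),\tilde{\boldsymbol\zeta}_h-\nu\nabla\tilde\xi_h\big),\qquad \Delta_h=\|\tilde{\boldsymbol q}_h+\nu\nabla\tilde u_h\|\,\|\tilde{\boldsymbol\zeta}_h+\nu\nabla\tilde\xi_h\|,$$ and consequently $|s-\tilde s_h|\le\tfrac12\Delta_h$. -/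

import Mathlib

open MeasureTheory Filter Topology
open scoped ENNReal Gradient ContDiff

namespace PoissonBounds

noncomputable section

/-- Euclidean space `ℝ^d`. -/
abbrev Sp (d : ℕ) : Type := EuclideanSpace ℝ (Fin d)

/-- Surface measure on hypersurfaces of `ℝ^d`: the `(d-1)`-dimensional Hausdorff measure, normalised
so that it is the usual length (`d = 2`) or area (`d = 3`). -/
def surf (d : ℕ) : Measure (Sp d) := Measure.euclideanHausdorffMeasure (d - 1)

/-- Polygonal / polyhedral domains: open, connected and non-empty, the closure is a finite union of
nondegenerate `d`-simplices, and the domain lies on one side only of its boundary (no slits). -/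
structure IsPolyhedralDomain {d : ℕ} (Ω : Set (Sp d)) : Prop where
  isOpen : IsOpen Ω
  isConnected : IsConnected Ω
  interior_closure : interior (closure Ω) = Ω
  exists_simplices : ∃ T : Set (Affine.Simplex ℝ (Sp d) d), T.Finite ∧
    closure Ω = ⋃ K ∈ T, convexHull ℝ (Set.range K.points)

/-- The boundary of `Ω` is divided into the two disjoint parts `ΓD` (non-empty) and `ΓN`, whose
closures cover it; the points that belong to neither part and the interface between the two parts
have zero surface measure. -/
structure IsBoundaryPartition {d : ℕ} (Ω ΓD ΓN : Set (Sp d)) : Prop where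
  subset_D : ΓD ⊆ frontier Ω
  subset_N : ΓN ⊆ frontier Ω
  disjoint : Disjoint ΓD ΓN
  closure_union : closure ΓD ∪ closure ΓN = frontier Ω
  nonempty_D : ΓD.Nonempty
  null_rest : surf d (frontier Ω \ (ΓD ∪ ΓN)) = 0
  null_interface : surf d (closure ΓD ∩ closure ΓN) = 0

/-- `ν ∈ L^∞(Ω)`, bounded below by a positive constant. Every positive piecewise constant function
with finitely many measurable pieces is of this kind. -/
structure IsDiffusivity {d : ℕ} (Ω : Set (Sp d)) (ν : Sp d → ℝ) : Prop where
  aestronglyMeasurable : AEStronglyMeasurable ν (volume.restrict Ω)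
  bounds : ∃ α β : ℝ, 0 < α ∧ ∀ᵐ x ∂(volume.restrict Ω), α ≤ ν x ∧ ν x ≤ β

/-- `φ` is a test function on `Ω`, that is, `φ ∈ C_c^∞(Ω)`. -/
def IsTestFunction {d : ℕ} (Ω : Set (Sp d)) (φ : Sp d → ℝ) : Prop :=
  ContDiff ℝ ∞ φ ∧ HasCompactSupport φ ∧ tsupport φ ⊆ Ω

/-- `G` is the weak gradient of `w` in `Ω`. -/
def IsWeakGradient {d : ℕ} (Ω : Set (Sp d)) (w : Sp d → ℝ) (G : Sp d → Sp d) : Prop :=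
  ∀ φ : Sp d → ℝ, IsTestFunction Ω φ →
    ∫ x in Ω, w x • ∇ φ x = - ∫ x in Ω, φ x • G x

/-- `g` is the weak divergence of `v` in `Ω`. -/
def IsWeakDivergence {d : ℕ} (Ω : Set (Sp d)) (v : Sp d → Sp d) (g : Sp d → ℝ) : Prop :=
  ∀ φ : Sp d → ℝ, IsTestFunction Ω φ →
    ∫ x in Ω, inner ℝ (v x) (∇ φ x) = - ∫ x in Ω, g x * φ x

/-- `t` is the boundary trace of the `H^1(Ω)` function `w` with weak gradient `G`: functions smooth
up to the boundary converge to `w` in `H^1(Ω)` and their restrictions converge to `t` in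
`L^2(∂Ω)`. -/
def IsTrace {d : ℕ} (Ω : Set (Sp d)) (w : Sp d → ℝ) (G : Sp d → Sp d) (t : Sp d → ℝ) : Prop :=
  ∃ φ : ℕ → Sp d → ℝ, (∀ n, ContDiff ℝ ∞ (φ n)) ∧
    Tendsto (fun n => eLpNorm (fun x => φ n x - w x) 2 (volume.restrict Ω)) atTop (𝓝 0) ∧
    Tendsto (fun n => eLpNorm (fun x => ∇ (φ n) x - G x) 2 (volume.restrict Ω)) atTop (𝓝 0) ∧
    Tendsto (fun n => eLpNorm (fun x => φ n x - t x) 2 ((surf d).restrict (frontier Ω)))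
      atTop (𝓝 0)

/-- The space `H^1(Ω)`. A function comes together with its weak gradient and its boundary trace;
by the trace theorem both exist and are determined by the function (almost everywhere) when `Ω` is
a polyhedral domain. -/
structure H1 {d : ℕ} (Ω : Set (Sp d)) where
  toFun : Sp d → ℝ
  grad : Sp d → Sp d
  trace : Sp d → ℝ
  memLp : MemLp toFun 2 (volume.restrict Ω)
  memLp_grad : MemLp grad 2 (volume.restrict Ω)
  memLp_trace : MemLp trace 2 ((surf d).restrict (frontier Ω))
  isWeakGradient : IsWeakGradient Ω toFun grad
  isTrace : IsTrace Ω toFun grad trace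

/-- `w = g` on the boundary part `Γ`, in the sense of traces. -/
def H1.EqOn {d : ℕ} {Ω : Set (Sp d)} (w : H1 Ω) (g : Sp d → ℝ) (Γ : Set (Sp d)) : Prop :=
  w.trace =ᵐ[(surf d).restrict Γ] g

/-- The Green functional `w ↦ (v, ∇w) + (div v, w)` of a field `v` with divergence `g`; it is the
duality pairing `⟨v·n, w⟩` on the whole boundary `∂Ω`. -/
def green {d : ℕ} {Ω : Set (Sp d)} (v : Sp d → Sp d) (g : Sp d → ℝ) (w : H1 Ω) : ℝ :=
  (∫ x in Ω, inner ℝ (v x) (w.grad x)) + ∫ x in Ω, g x * w.toFun x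

/-- The normal trace `v·n` of a field `v ∈ H(div; Ω)` with divergence `g` equals `t` on `ΓN`: the
Green formula holds for all `w ∈ H^1(Ω)` that vanish on `ΓD`. -/
def IsNormalTrace {d : ℕ} (Ω ΓD ΓN : Set (Sp d)) (v : Sp d → Sp d) (g t : Sp d → ℝ) : Prop :=
  ∀ w : H1 Ω, w.EqOn 0 ΓD → green v g w = ∫ x in ΓN, t x * w.trace x ∂(surf d)

/-- The fields of `H(div; Ω)` for which the boundary pairings of the mixed formulation make sense,
namely those whose normal trace on `ΓN` is in `L^2(ΓN)`. A field comes together with its weak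
divergence and its normal trace on `ΓN`, both determined by the field (almost everywhere). -/
structure Hdiv {d : ℕ} (Ω ΓD ΓN : Set (Sp d)) where
  toFun : Sp d → Sp d
  div : Sp d → ℝ
  normalTrace : Sp d → ℝ
  memLp : MemLp toFun 2 (volume.restrict Ω)
  memLp_div : MemLp div 2 (volume.restrict Ω)
  memLp_normalTrace : MemLp normalTrace 2 ((surf d).restrict ΓN)
  isWeakDivergence : IsWeakDivergence Ω toFun div
  isNormalTrace : IsNormalTrace Ω ΓD ΓN toFun div normalTrace

variable {d : ℕ} {Ω ΓD ΓN : Set (Sp d)}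

/-- The pairing `⟨v·n, w⟩` on `ΓD` for `w ∈ H^1(Ω)`: the pairing on `∂Ω` minus the integral
over `ΓN`. -/
def Hdiv.pairD (v : Hdiv Ω ΓD ΓN) (w : H1 Ω) : ℝ :=
  green v.toFun v.div w - ∫ x in ΓN, v.normalTrace x * w.trace x ∂(surf d)

open Classical in
/-- The pairing `⟨g, v·n⟩` on `ΓD` for a function `g` on `ΓD` that is the trace of some function of
`H^1(Ω)`; it does not depend on the extension of `g` that is used. (The value `0` for functions
`g` that have no extension in `H^1(Ω)` is a mere convention.) -/
def Hdiv.pairData (v : Hdiv Ω ΓD ΓN) (g : Sp d → ℝ) : ℝ :=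
  if h : ∃ w : H1 Ω, w.EqOn g ΓD then v.pairD h.choose else 0

/-- The bilinear form `a(u, q; w, v)` of the mixed formulation. -/
def aForm (ν : Sp d → ℝ) (u : H1 Ω) (q : Hdiv Ω ΓD ΓN) (w : H1 Ω) (v : Hdiv Ω ΓD ΓN) : ℝ :=
  (∫ x in Ω, (ν x)⁻¹ * inner ℝ (q.toFun x) (v.toFun x))
    - (∫ x in Ω, u.toFun x * v.div x)
    + (∫ x in ΓN, u.trace x * v.normalTrace x ∂(surf d))
    - (∫ x in Ω, inner ℝ (q.toFun x) (w.grad x))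
    + q.pairD w

/-- The linear form `ℓ(w, v)` of the mixed formulation with data `f, gD, gN`. -/
def lForm (f gD gN : Sp d → ℝ) (w : H1 Ω) (v : Hdiv Ω ΓD ΓN) : ℝ :=
  (∫ x in Ω, f x * w.toFun x) - v.pairData gD - ∫ x in ΓN, gN x * w.trace x ∂(surf d)

/-- The output functional `ℓ^O(w, v)` with data `fO, gDO, gNO`. -/
def outputForm (fO gDO gNO : Sp d → ℝ) (w : H1 Ω) (v : Hdiv Ω ΓD ΓN) : ℝ :=
  (∫ x in Ω, fO x * w.toFun x) + v.pairData gDO + ∫ x in ΓN, gNO x * w.trace x ∂(surf d)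

/-- `(u, q)` is a weak solution of the mixed formulation: `a(u, q; w, v) = ℓ(w, v)` for all test
pairs `(w, v)`. -/
def IsWeakSolution (ν f gD gN : Sp d → ℝ) (u : H1 Ω) (q : Hdiv Ω ΓD ΓN) : Prop :=
  ∀ (w : H1 Ω) (v : Hdiv Ω ΓD ΓN), aForm ν u q w v = lForm f gD gN w v

/-- `(w, v)` is a pair of a potential reconstruction and an equilibrated flux reconstruction for
the problem with source `f`, Dirichlet datum `gD` and flux datum `gN`: `w = gD` on `ΓD`,
`div v = f` in `Ω`, and `v·n = gN` on `ΓN`. -/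
structure IsReconstruction (f gD gN : Sp d → ℝ) (w : H1 Ω) (v : Hdiv Ω ΓD ΓN) : Prop where
  dirichlet : w.EqOn gD ΓD
  equilibrium : v.div =ᵐ[volume.restrict Ω] f
  neumann : v.normalTrace =ᵐ[(surf d).restrict ΓN] gN

/-- The weighted inner product `(ν⁻¹ v, z)` over `Ω`. -/
def energyInner (Ω : Set (Sp d)) (ν : Sp d → ℝ) (v z : Sp d → Sp d) : ℝ :=
  ∫ x in Ω, inner ℝ ((ν x)⁻¹ • v x) (z x)

/-- The energy norm `‖v‖ = (ν⁻¹ v, v)^{1/2}`. -/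
def energyNorm (Ω : Set (Sp d)) (ν : Sp d → ℝ) (v : Sp d → Sp d) : ℝ :=
  √(energyInner Ω ν v v)

/-- The field `v + ν ∇w`. -/
def fluxSum (ν : Sp d → ℝ) (w : H1 Ω) (v : Hdiv Ω ΓD ΓN) : Sp d → Sp d :=
  fun x => v.toFun x + ν x • w.grad x

/-- The field `v - ν ∇w`. -/
def fluxDiff (ν : Sp d → ℝ) (w : H1 Ω) (v : Hdiv Ω ΓD ΓN) : Sp d → Sp d :=
  fun x => v.toFun x - ν x • w.grad x

/-- The lower bound `s_h^-` computed from primal reconstructions `(u, q)` and adjoint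
reconstructions `(ξ, ζ)`. -/
def lowerBound (ν fO gDO gNO : Sp d → ℝ) (u : H1 Ω) (q : Hdiv Ω ΓD ΓN) (ξ : H1 Ω)
    (ζ : Hdiv Ω ΓD ΓN) : ℝ :=
  outputForm fO gDO gNO u q + 1 / 2 * energyInner Ω ν (fluxSum ν u q) (fluxDiff ν ξ ζ)
    - 1 / 2 * (energyNorm Ω ν (fluxSum ν u q) * energyNorm Ω ν (fluxSum ν ξ ζ))

/-- The upper bound `s_h^+`. -/
def upperBound (ν fO gDO gNO : Sp d → ℝ) (u : H1 Ω) (q : Hdiv Ω ΓD ΓN) (ξ : H1 Ω)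
    (ζ : Hdiv Ω ΓD ΓN) : ℝ :=
  outputForm fO gDO gNO u q + 1 / 2 * energyInner Ω ν (fluxSum ν u q) (fluxDiff ν ξ ζ)
    + 1 / 2 * (energyNorm Ω ν (fluxSum ν u q) * energyNorm Ω ν (fluxSum ν ξ ζ))

/-- The bound average, the midpoint of the two bounds. -/
def boundAverage (ν fO gDO gNO : Sp d → ℝ) (u : H1 Ω) (q : Hdiv Ω ΓD ΓN) (ξ : H1 Ω)
    (ζ : Hdiv Ω ΓD ΓN) : ℝ :=
  1 / 2 * (upperBound ν fO gDO gNO u q ξ ζ + lowerBound ν fO gDO gNO u q ξ ζ)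

/-- The bound gap, the distance of the two bounds. -/
def boundGap (ν fO gDO gNO : Sp d → ℝ) (u : H1 Ω) (q : Hdiv Ω ΓD ΓN) (ξ : H1 Ω)
    (ζ : Hdiv Ω ΓD ΓN) : ℝ :=
  upperBound ν fO gDO gNO u q ξ ζ - lowerBound ν fO gDO gNO u q ξ ζ

end

end PoissonBounds

namespace PoissonBounds

noncomputable section

/-! Write `e = q - qh`, `E = qh + ν∇uh`, `Z = ζh + ν∇ξh`, with products weighted by `ν⁻¹`. Formally
`e + E = -ν∇(u - uh)`, where `e` is divergence-free with zero flux through `ΓN` and `u - uh`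
vanishes on `ΓD`. Hence `(e, e + E) = 0` (`prager_synge`), so `e` lies on the sphere with diameter
from `0` to `-E`, that is, `‖e + E/2‖ = ‖E‖/2`.

Integration by parts against the adjoint reconstructions gives the output error as `(e, Z) + (E,
ζh)` (`output_sub`). Subtracting the computable term `½(E, ζh - ν∇ξh)` leaves `(e + E/2, Z)`.
Cauchy–Schwarz (`abs_energyInner_le`) and the sphere identity bound this by `½‖E‖‖Z‖`; the factor ½
comes from centring at the midpoint.

The strong law `q = -ν∇u` is never derived: the weak equations are tested with the exact solution
and the reconstructions themselves. -/

theorem tendsto_eLpNorm_sub_sub {α E : Type*} [MeasurableSpace α] {μ : Measure α}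
    [NormedAddCommGroup E] {f g : ℕ → α → E} {F G : α → E}
    (hfF : ∀ n, AEStronglyMeasurable (fun x => f n x - F x) μ)
    (hgG : ∀ n, AEStronglyMeasurable (fun x => g n x - G x) μ)
    (hf : Tendsto (fun n => eLpNorm (fun x => f n x - F x) 2 μ) atTop (𝓝 0))
    (hg : Tendsto (fun n => eLpNorm (fun x => g n x - G x) 2 μ) atTop (𝓝 0)) :
    Tendsto (fun n => eLpNorm (fun x => (f n x - g n x) - (F x - G x)) 2 μ) atTop (𝓝 0) := by
  have hsum := hf.add hg
  rw [add_zero] at hsum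
  refine tendsto_of_tendsto_of_tendsto_of_le_of_le tendsto_const_nhds hsum
    (fun _ => zero_le) fun n => ?_
  have heq : (fun x => (f n x - g n x) - (F x - G x)) =
      (fun x => f n x - F x) - (fun x => g n x - G x) := by
    funext x
    simp only [Pi.sub_apply]
    abel
  simp only [heq]
  exact eLpNorm_sub_le (hfF n) (hgG n) (by norm_num)

/-! ### Integrability of `L²` pairings -/

section IntegralBilinearity

variable {α E : Type*} [MeasurableSpace α] {μ : Measure α}
  [NormedAddCommGroup E] [InnerProductSpace ℝ E]

theorem integrable_mul_of_memLp_two {f g : α → ℝ} (hf : MemLp f 2 μ) (hg : MemLp g 2 μ) :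
    Integrable (fun x => f x * g x) μ :=
  MemLp.integrable_mul hf hg

theorem integrable_smul_of_memLp_two {f : α → ℝ} {g : α → E} (hf : MemLp f 2 μ)
    (hg : MemLp g 2 μ) : Integrable (fun x => f x • g x) μ :=
  memLp_one_iff_integrable.1 (MemLp.smul hg hf)

theorem integrable_inner_of_memLp_two {f g : α → E} (hf : MemLp f 2 μ) (hg : MemLp g 2 μ) :
    Integrable (fun x => inner ℝ (f x) (g x)) μ := by
  refine (integrable_mul_of_memLp_two hf.norm hg.norm).mono' (hf.1.inner hg.1) ?_
  exact Eventually.of_forall fun x => norm_inner_le_norm (f x) (g x)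

end IntegralBilinearity

variable {d : ℕ} {Ω ΓD ΓN : Set (Sp d)}

/-! ### Differences and boundary pairings in `H1` and `Hdiv` -/

theorem continuous_gradient {φ : Sp d → ℝ} (hφ : ContDiff ℝ ∞ φ) : Continuous (∇ φ) :=
  (InnerProductSpace.toDual ℝ (Sp d)).symm.continuous.comp (hφ.continuous_fderiv (by simp))

theorem gradient_sub_of_contDiff {φ ψ : Sp d → ℝ} (hφ : ContDiff ℝ ∞ φ) (hψ : ContDiff ℝ ∞ ψ)
    (x : Sp d) : ∇ (fun y => φ y - ψ y) x = ∇ φ x - ∇ ψ x := by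
  have h := fderiv_fun_sub (hφ.differentiable (by simp) x) (hψ.differentiable (by simp) x)
  simp only [gradient, h, map_sub]

theorem IsTestFunction.memLp {φ : Sp d → ℝ} (hφ : IsTestFunction Ω φ) (μ : Measure (Sp d))
    [IsFiniteMeasureOnCompacts μ] : MemLp φ 2 μ :=
  hφ.1.continuous.memLp_of_hasCompactSupport hφ.2.1

theorem IsTestFunction.memLp_gradient {φ : Sp d → ℝ} (hφ : IsTestFunction Ω φ)
    (μ : Measure (Sp d)) [IsFiniteMeasureOnCompacts μ] : MemLp (∇ φ) 2 μ :=
  (continuous_gradient hφ.1).memLp_of_hasCompactSupport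
    ((hφ.2.1.fderiv (𝕜 := ℝ)).comp_left (map_zero (InnerProductSpace.toDual ℝ (Sp d)).symm))

/-- Differences in `H^1(Ω)`. -/
def H1.sub (u w : H1 Ω) : H1 Ω where
  toFun x := u.toFun x - w.toFun x
  grad x := u.grad x - w.grad x
  trace x := u.trace x - w.trace x
  memLp := u.memLp.sub w.memLp
  memLp_grad := u.memLp_grad.sub w.memLp_grad
  memLp_trace := u.memLp_trace.sub w.memLp_trace
  isWeakGradient φ hφ := by
    have hg := hφ.memLp_gradient (volume.restrict Ω)
    have hm := hφ.memLp (volume.restrict Ω)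
    simp only [sub_smul, smul_sub]
    rw [integral_sub (integrable_smul_of_memLp_two u.memLp hg)
        (integrable_smul_of_memLp_two w.memLp hg),
      integral_sub (integrable_smul_of_memLp_two hm u.memLp_grad)
        (integrable_smul_of_memLp_two hm w.memLp_grad),
      u.isWeakGradient φ hφ, w.isWeakGradient φ hφ]
    abel
  isTrace := by
    obtain ⟨φ, hφ, hφ₀, hφ₁, hφ₂⟩ := u.isTrace
    obtain ⟨ψ, hψ, hψ₀, hψ₁, hψ₂⟩ := w.isTrace
    refine ⟨fun n x => φ n x - ψ n x, fun n => (hφ n).sub (hψ n), ?_, ?_, ?_⟩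
    · exact tendsto_eLpNorm_sub_sub
        (fun n => (hφ n).continuous.aestronglyMeasurable.sub u.memLp.1)
        (fun n => (hψ n).continuous.aestronglyMeasurable.sub w.memLp.1) hφ₀ hψ₀
    · simp only [gradient_sub_of_contDiff (hφ _) (hψ _)]
      exact tendsto_eLpNorm_sub_sub
        (fun n => (continuous_gradient (hφ n)).aestronglyMeasurable.sub u.memLp_grad.1)
        (fun n => (continuous_gradient (hψ n)).aestronglyMeasurable.sub w.memLp_grad.1) hφ₁ hψ₁
    · exact tendsto_eLpNorm_sub_sub
        (fun n => (hφ n).continuous.aestronglyMeasurable.sub u.memLp_trace.1)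
        (fun n => (hψ n).continuous.aestronglyMeasurable.sub w.memLp_trace.1) hφ₂ hψ₂

/-- Makes the `ΓN` boundary integrals finite, so that they may be split over differences. -/
theorem H1.memLp_trace_restrict (w : H1 Ω) (hN : ΓN ⊆ frontier Ω) :
    MemLp w.trace 2 ((surf d).restrict ΓN) :=
  w.memLp_trace.mono_measure (Measure.restrict_mono hN le_rfl)

theorem green_sub_left {v z : Sp d → Sp d} {g h : Sp d → ℝ}
    (hv : MemLp v 2 (volume.restrict Ω)) (hz : MemLp z 2 (volume.restrict Ω))
    (hg : MemLp g 2 (volume.restrict Ω)) (hh : MemLp h 2 (volume.restrict Ω)) (w : H1 Ω) :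
    green (fun x => v x - z x) (fun x => g x - h x) w = green v g w - green z h w := by
  simp only [green, inner_sub_left, sub_mul]
  rw [integral_sub (integrable_inner_of_memLp_two hv w.memLp_grad)
      (integrable_inner_of_memLp_two hz w.memLp_grad),
    integral_sub (integrable_mul_of_memLp_two hg w.memLp) (integrable_mul_of_memLp_two hh w.memLp)]
  ring

theorem green_sub_right {v : Sp d → Sp d} {g : Sp d → ℝ}
    (hv : MemLp v 2 (volume.restrict Ω)) (hg : MemLp g 2 (volume.restrict Ω)) (u w : H1 Ω) :
    green v g (u.sub w) = green v g u - green v g w := by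
  simp only [green, H1.sub, inner_sub_right, mul_sub]
  rw [integral_sub (integrable_inner_of_memLp_two hv u.memLp_grad)
      (integrable_inner_of_memLp_two hv w.memLp_grad),
    integral_sub (integrable_mul_of_memLp_two hg u.memLp) (integrable_mul_of_memLp_two hg w.memLp)]
  ring

/-- Differences of fields with a normal trace. -/
def Hdiv.sub (hN : ΓN ⊆ frontier Ω) (v z : Hdiv Ω ΓD ΓN) : Hdiv Ω ΓD ΓN where
  toFun x := v.toFun x - z.toFun x
  div x := v.div x - z.div x
  normalTrace x := v.normalTrace x - z.normalTrace x
  memLp := v.memLp.sub z.memLp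
  memLp_div := v.memLp_div.sub z.memLp_div
  memLp_normalTrace := v.memLp_normalTrace.sub z.memLp_normalTrace
  isWeakDivergence φ hφ := by
    have hg := hφ.memLp_gradient (volume.restrict Ω)
    have hm := hφ.memLp (volume.restrict Ω)
    simp only [inner_sub_left, sub_mul]
    rw [integral_sub (integrable_inner_of_memLp_two v.memLp hg)
        (integrable_inner_of_memLp_two z.memLp hg),
      integral_sub (integrable_mul_of_memLp_two v.memLp_div hm)
        (integrable_mul_of_memLp_two z.memLp_div hm),
      v.isWeakDivergence φ hφ, z.isWeakDivergence φ hφ]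
    ring
  isNormalTrace w hw := by
    have ht := w.memLp_trace_restrict hN
    rw [green_sub_left v.memLp z.memLp v.memLp_div z.memLp_div, v.isNormalTrace w hw,
      z.isNormalTrace w hw]
    simp only [sub_mul]
    rw [integral_sub (integrable_mul_of_memLp_two v.memLp_normalTrace ht)
      (integrable_mul_of_memLp_two z.memLp_normalTrace ht)]

/-- The pairing on `ΓD` depends only on the trace on `ΓD`. -/
theorem Hdiv.pairD_congr (hN : ΓN ⊆ frontier Ω) (v : Hdiv Ω ΓD ΓN) {u w : H1 Ω} {g : Sp d → ℝ}
    (hu : u.EqOn g ΓD) (hw : w.EqOn g ΓD) : v.pairD u = v.pairD w := by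
  -- A difference of two extensions of `g` is admissible in the Green formula defining the normal
  -- trace, which says that its `ΓD` pairing vanishes.
  have hzero : (u.sub w).EqOn 0 ΓD := by
    filter_upwards [hu, hw] with x hx hx'
    simp [H1.sub, hx, hx']
  have h := v.isNormalTrace _ hzero
  rw [green_sub_right v.memLp v.memLp_div] at h
  simp only [H1.sub, mul_sub] at h
  rw [integral_sub
    (integrable_mul_of_memLp_two v.memLp_normalTrace (u.memLp_trace_restrict hN))
    (integrable_mul_of_memLp_two v.memLp_normalTrace (w.memLp_trace_restrict hN))] at h
  simp only [Hdiv.pairD]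
  linarith

/-- The chosen extension is irrelevant, so `uh` and `ξh` can serve as extensions of the Dirichlet
data. -/
theorem Hdiv.pairData_eq (hN : ΓN ⊆ frontier Ω) (v : Hdiv Ω ΓD ΓN) {w : H1 Ω} {g : Sp d → ℝ}
    (hw : w.EqOn g ΓD) : v.pairData g = v.pairD w := by
  have hex : ∃ w : H1 Ω, w.EqOn g ΓD := ⟨w, hw⟩
  rw [Hdiv.pairData, dif_pos hex]
  exact v.pairD_congr hN hex.choose_spec hw

/-! ### The two equations contained in the mixed formulation -/

/-- The weak form of the equilibrium and of the flux condition. -/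
theorem IsWeakSolution.equilibrium {ν f gD gN : Sp d → ℝ} {u uh : H1 Ω} {q : Hdiv Ω ΓD ΓN}
    (hN : ΓN ⊆ frontier Ω) (huh : uh.EqOn gD ΓD) (h : IsWeakSolution ν f gD gN u q) (w : H1 Ω) :
    (∫ x in Ω, q.div x * w.toFun x) - ∫ x in ΓN, q.normalTrace x * w.trace x ∂(surf d) =
      (∫ x in Ω, f x * w.toFun x) - ∫ x in ΓN, gN x * w.trace x ∂(surf d) := by
  -- `q - q` is the zero test field; only the terms tested by `w` survive.
  have h0 := h w (Hdiv.sub hN q q)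
  rw [lForm, Hdiv.pairData_eq hN _ huh] at h0
  simp [aForm, Hdiv.pairD, green, Hdiv.sub] at h0
  linarith

/-- The weak form of the constitutive law and of the Dirichlet condition. -/
theorem IsWeakSolution.constitutive {ν f gD gN : Sp d → ℝ} {u uh : H1 Ω} {q : Hdiv Ω ΓD ΓN}
    (hN : ΓN ⊆ frontier Ω) (huh : uh.EqOn gD ΓD) (h : IsWeakSolution ν f gD gN u q)
    (v : Hdiv Ω ΓD ΓN) :
    energyInner Ω ν q.toFun v.toFun + (∫ x in Ω, inner ℝ (v.toFun x) (uh.grad x)) =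
      (∫ x in Ω, v.div x * u.toFun x) - (∫ x in Ω, v.div x * uh.toFun x)
        - (∫ x in ΓN, v.normalTrace x * u.trace x ∂(surf d))
        + ∫ x in ΓN, v.normalTrace x * uh.trace x ∂(surf d) := by
  -- `u - u` is the zero potential, and `uh` turns the Dirichlet pairing into Green's terms.
  have h0 := h (u.sub u) v
  rw [lForm, Hdiv.pairData_eq hN _ huh] at h0
  simp only [aForm, Hdiv.pairD, green, H1.sub, sub_self, inner_zero_right, mul_zero,
    integral_zero, mul_comm (u.toFun _), mul_comm (u.trace _)] at h0
  simp only [energyInner, real_inner_smul_left]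
  linarith

/-! ### The energy inner product -/

section Energy

variable {ν : Sp d → ℝ} {a b c : Sp d → Sp d}

theorem IsDiffusivity.memLp_inv_smul (hν : IsDiffusivity Ω ν)
    (ha : MemLp a 2 (volume.restrict Ω)) :
    MemLp (fun x => (ν x)⁻¹ • a x) 2 (volume.restrict Ω) := by
  obtain ⟨α, β, hα, hb⟩ := hν.bounds
  refine ha.of_le_mul (c := α⁻¹)
    (hν.aestronglyMeasurable.aemeasurable.inv.aestronglyMeasurable.smul ha.1) ?_
  filter_upwards [hb] with x hx
  have hpos : 0 < ν x := hα.trans_le hx.1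
  rw [norm_smul, norm_inv, Real.norm_of_nonneg hpos.le]
  gcongr
  exact hx.1

theorem IsDiffusivity.memLp_smul (hν : IsDiffusivity Ω ν)
    (ha : MemLp a 2 (volume.restrict Ω)) :
    MemLp (fun x => ν x • a x) 2 (volume.restrict Ω) := by
  obtain ⟨α, β, hα, hb⟩ := hν.bounds
  refine ha.of_le_mul (c := β) (hν.aestronglyMeasurable.smul ha.1) ?_
  filter_upwards [hb] with x hx
  rw [norm_smul, Real.norm_of_nonneg (hα.trans_le hx.1).le]
  gcongr
  exact hx.2

theorem IsDiffusivity.integrable_energy (hν : IsDiffusivity Ω ν)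
    (ha : MemLp a 2 (volume.restrict Ω)) (hb : MemLp b 2 (volume.restrict Ω)) :
    Integrable (fun x => inner ℝ ((ν x)⁻¹ • a x) (b x)) (volume.restrict Ω) :=
  integrable_inner_of_memLp_two (hν.memLp_inv_smul ha) hb

theorem energyInner_comm : energyInner Ω ν a b = energyInner Ω ν b a := by
  simp only [energyInner, real_inner_smul_left]
  simp only [real_inner_comm]

theorem energyInner_add_right (hν : IsDiffusivity Ω ν) (ha : MemLp a 2 (volume.restrict Ω))
    (hb : MemLp b 2 (volume.restrict Ω)) (hc : MemLp c 2 (volume.restrict Ω)) :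
    energyInner Ω ν a (b + c) = energyInner Ω ν a b + energyInner Ω ν a c := by
  simp only [energyInner, Pi.add_apply, inner_add_right]
  exact integral_add (hν.integrable_energy ha hb) (hν.integrable_energy ha hc)

theorem energyInner_smul_right (t : ℝ) :
    energyInner Ω ν a (t • b) = t * energyInner Ω ν a b := by
  simp only [energyInner, Pi.smul_apply, real_inner_smul_right, integral_const_mul]

theorem energyInner_sub_right (hν : IsDiffusivity Ω ν) (ha : MemLp a 2 (volume.restrict Ω))
    (hb : MemLp b 2 (volume.restrict Ω)) (hc : MemLp c 2 (volume.restrict Ω)) :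
    energyInner Ω ν a (b - c) = energyInner Ω ν a b - energyInner Ω ν a c := by
  simp only [energyInner, Pi.sub_apply, inner_sub_right]
  exact integral_sub (hν.integrable_energy ha hb) (hν.integrable_energy ha hc)

theorem energyInner_self_nonneg (hν : IsDiffusivity Ω ν) : 0 ≤ energyInner Ω ν a a := by
  obtain ⟨α, β, hα, hb⟩ := hν.bounds
  refine integral_nonneg_of_ae ?_
  filter_upwards [hb] with x hx
  rw [real_inner_smul_left]
  exact mul_nonneg (inv_nonneg.2 (hα.trans_le hx.1).le) real_inner_self_nonneg

/-- The weight cancels, turning energy products with `ν∇w` into the unweighted pairings of Green's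
formula. -/
theorem energyInner_smul_diffusivity (hν : IsDiffusivity Ω ν) :
    energyInner Ω ν a (fun x => ν x • b x) = ∫ x in Ω, inner ℝ (a x) (b x) := by
  obtain ⟨α, β, hα, hb⟩ := hν.bounds
  refine integral_congr_ae ?_
  filter_upwards [hb] with x hx
  have hne : ν x ≠ 0 := (hα.trans_le hx.1).ne'
  rw [real_inner_smul_left, real_inner_smul_right, inv_mul_cancel_left₀ hne]

/-- Bilinear expansion of the square of `a + t b`. -/
theorem energyInner_add_smul_self (hν : IsDiffusivity Ω ν) (ha : MemLp a 2 (volume.restrict Ω))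
    (hb : MemLp b 2 (volume.restrict Ω)) (t : ℝ) :
    energyInner Ω ν (a + t • b) (a + t • b) =
      energyInner Ω ν b b * (t * t) + 2 * energyInner Ω ν a b * t + energyInner Ω ν a a := by
  have htb := hb.const_smul t
  rw [energyInner_add_right hν (ha.add htb) ha htb, energyInner_smul_right,
    energyInner_comm (b := a), energyInner_comm (b := b), energyInner_add_right hν ha ha htb,
    energyInner_add_right hν hb ha htb, energyInner_smul_right, energyInner_smul_right,
    energyInner_comm (a := b) (b := a)]
  ring

/-- The Cauchy–Schwarz inequality for the energy inner product. -/
theorem abs_energyInner_le (hν : IsDiffusivity Ω ν) (ha : MemLp a 2 (volume.restrict Ω))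
    (hb : MemLp b 2 (volume.restrict Ω)) :
    |energyInner Ω ν a b| ≤ energyNorm Ω ν a * energyNorm Ω ν b := by
  -- The quadratic `t ↦ ‖a + t b‖²` is nonnegative; semidefiniteness suffices here.
  have h : discrim (energyInner Ω ν b b) (2 * energyInner Ω ν a b) (energyInner Ω ν a a) ≤ 0 :=
    discrim_le_zero fun t => by
      rw [← energyInner_add_smul_self hν ha hb t]
      exact energyInner_self_nonneg hν
  rw [energyNorm, energyNorm, ← Real.sqrt_mul (energyInner_self_nonneg hν)]
  refine Real.abs_le_sqrt ?_
  rw [discrim] at h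
  linarith

end Energy

/-! ### Error identities and the midpoint estimate -/

/-- The Prager–Synge identity: the error of the equilibrated flux is orthogonal to the error of
the gradient of the potential. -/
theorem IsWeakSolution.prager_synge {ν f gD gN : Sp d → ℝ} {u uh : H1 Ω} {q qh : Hdiv Ω ΓD ΓN}
    (hν : IsDiffusivity Ω ν) (hN : ΓN ⊆ frontier Ω) (h : IsWeakSolution ν f gD gN u q)
    (hr : IsReconstruction f gD gN uh qh) :
    energyInner Ω ν (q.toFun - qh.toFun) ((q.toFun - qh.toFun) + fluxSum ν uh qh) = 0 := by
  have hF : MemLp (fun x => ν x • uh.grad x) 2 (volume.restrict Ω) := hν.memLp_smul uh.memLp_grad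
  have heq : (q.toFun - qh.toFun) + fluxSum ν uh qh = q.toFun + fun x => ν x • uh.grad x := by
    funext x
    simp only [fluxSum, Pi.add_apply, Pi.sub_apply]
    abel
  have hdiv : ∀ w : H1 Ω, ∫ x in Ω, qh.div x * w.toFun x = ∫ x in Ω, f x * w.toFun x :=
    fun w => integral_congr_ae (hr.equilibrium.mul (EventuallyEq.refl _ w.toFun))
  have hnt : ∀ w : H1 Ω, ∫ x in ΓN, qh.normalTrace x * w.trace x ∂(surf d) =
      ∫ x in ΓN, gN x * w.trace x ∂(surf d) :=
    fun w => integral_congr_ae (hr.neumann.mul (EventuallyEq.refl _ w.trace))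
  -- Differencing the constitutive law over `q`, `qh` leaves volume and `ΓN` terms in `u - uh`;
  -- equilibrium tested with `u` and `uh` cancels them.
  have hq := h.constitutive hN hr.dirichlet q
  have hqh := h.constitutive hN hr.dirichlet qh
  have hu := h.equilibrium hN hr.dirichlet u
  have huh := h.equilibrium hN hr.dirichlet uh
  rw [hdiv, hdiv, hnt, hnt] at hqh
  rw [heq, energyInner_comm, energyInner_sub_right hν (q.memLp.add hF) q.memLp qh.memLp,
    energyInner_comm (b := q.toFun), energyInner_comm (b := qh.toFun),
    energyInner_add_right hν q.memLp q.memLp hF, energyInner_add_right hν qh.memLp q.memLp hF,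
    energyInner_smul_diffusivity hν, energyInner_smul_diffusivity hν,
    energyInner_comm (a := qh.toFun)]
  linarith

/-- Representation of the output error by the adjoint reconstructions. -/
theorem IsWeakSolution.output_sub {ν f gD gN fO gDO gNO : Sp d → ℝ} {u uh ξh : H1 Ω}
    {q qh ζh : Hdiv Ω ΓD ΓN} (hν : IsDiffusivity Ω ν) (hN : ΓN ⊆ frontier Ω)
    (h : IsWeakSolution ν f gD gN u q) (hr : IsReconstruction f gD gN uh qh)
    (ha : IsReconstruction fO gDO (fun x => - gNO x) ξh ζh) :
    outputForm fO gDO gNO u q - outputForm fO gDO gNO uh qh =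
      energyInner Ω ν (q.toFun - qh.toFun) (fluxSum ν ξh ζh)
        + energyInner Ω ν (fluxSum ν uh qh) ζh.toFun := by
  have hF : MemLp (fun x => ν x • uh.grad x) 2 (volume.restrict Ω) := hν.memLp_smul uh.memLp_grad
  have hX : MemLp (fun x => ν x • ξh.grad x) 2 (volume.restrict Ω) := hν.memLp_smul ξh.memLp_grad
  have hsum : fluxSum ν ξh ζh = ζh.toFun + fun x => ν x • ξh.grad x := rfl
  have hsum' : fluxSum ν uh qh = qh.toFun + fun x => ν x • uh.grad x := rfl
  have hdiv : ∫ x in Ω, qh.div x * ξh.toFun x = ∫ x in Ω, f x * ξh.toFun x :=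
    integral_congr_ae (hr.equilibrium.mul (EventuallyEq.refl _ ξh.toFun))
  have hnt : ∫ x in ΓN, qh.normalTrace x * ξh.trace x ∂(surf d) =
      ∫ x in ΓN, gN x * ξh.trace x ∂(surf d) :=
    integral_congr_ae (hr.neumann.mul (EventuallyEq.refl _ ξh.trace))
  have hdivO : ∀ w : H1 Ω, ∫ x in Ω, ζh.div x * w.toFun x = ∫ x in Ω, fO x * w.toFun x :=
    fun w => integral_congr_ae (ha.equilibrium.mul (EventuallyEq.refl _ w.toFun))
  have hntO : ∀ w : H1 Ω, ∫ x in ΓN, ζh.normalTrace x * w.trace x ∂(surf d) =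
      - ∫ x in ΓN, gNO x * w.trace x ∂(surf d) := fun w => by
    rw [← integral_neg]
    refine integral_congr_ae ?_
    filter_upwards [ha.neumann] with x hx
    rw [hx, neg_mul]
  -- Testing with `ζh` evaluates the `fO` and `gNO` parts of the output error. Testing with `ξh`
  -- removes the divergence and `ΓN` terms from the `gDO` part, leaving `(q - qh, ∇ξh)`.
  have hζ := h.constitutive hN hr.dirichlet ζh
  have hξ := h.equilibrium hN hr.dirichlet ξh
  rw [hdivO, hdivO, hntO, hntO] at hζ
  simp only [outputForm, Hdiv.pairData_eq hN _ ha.dirichlet, Hdiv.pairD, green]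
  rw [hdiv, hnt, energyInner_comm (b := ζh.toFun), hsum, hsum',
    energyInner_add_right hν (q.memLp.sub qh.memLp) ζh.memLp hX,
    energyInner_comm (b := ζh.toFun), energyInner_comm (b := fun x => ν x • ξh.grad x),
    energyInner_sub_right hν ζh.memLp q.memLp qh.memLp,
    energyInner_sub_right hν hX q.memLp qh.memLp,
    energyInner_comm (b := q.toFun), energyInner_comm (b := q.toFun),
    energyInner_comm (b := qh.toFun) (a := fun x => ν x • ξh.grad x),
    energyInner_smul_diffusivity hν, energyInner_smul_diffusivity hν,
    energyInner_add_right hν ζh.memLp qh.memLp hF, energyInner_smul_diffusivity hν]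
  linarith

/-- The output error relative to the bound average is at most half the product of the energy norms
of the primal and the adjoint residuals. -/
theorem IsWeakSolution.abs_output_sub_le {ν f gD gN fO gDO gNO : Sp d → ℝ} {u uh ξh : H1 Ω}
    {q qh ζh : Hdiv Ω ΓD ΓN} (hν : IsDiffusivity Ω ν) (hN : ΓN ⊆ frontier Ω)
    (h : IsWeakSolution ν f gD gN u q) (hr : IsReconstruction f gD gN uh qh)
    (ha : IsReconstruction fO gDO (fun x => - gNO x) ξh ζh) :
    |outputForm fO gDO gNO u q - (outputForm fO gDO gNO uh qh
        + 1 / 2 * energyInner Ω ν (fluxSum ν uh qh) (fluxDiff ν ξh ζh))| ≤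
      1 / 2 * (energyNorm Ω ν (fluxSum ν uh qh) * energyNorm Ω ν (fluxSum ν ξh ζh)) := by
  have hX : MemLp (fun x => ν x • ξh.grad x) 2 (volume.restrict Ω) := hν.memLp_smul ξh.memLp_grad
  have hE : MemLp (fluxSum ν uh qh) 2 (volume.restrict Ω) :=
    qh.memLp.add (hν.memLp_smul uh.memLp_grad)
  have hZ : MemLp (fluxSum ν ξh ζh) 2 (volume.restrict Ω) := ζh.memLp.add hX
  have he : MemLp (q.toFun - qh.toFun) 2 (volume.restrict Ω) := q.memLp.sub qh.memLp
  have hps := h.prager_synge hν hN hr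
  rw [energyInner_add_right hν he he hE] at hps
  have hmid := he.add (hE.const_smul (1 / 2 : ℝ))
  -- Expanding the square gives `(e, e) + (e, E) + ¼(E, E)`, whose first two terms sum to zero by
  -- `hps`.
  have hnorm : energyNorm Ω ν ((q.toFun - qh.toFun) + (1 / 2 : ℝ) • fluxSum ν uh qh) =
      1 / 2 * energyNorm Ω ν (fluxSum ν uh qh) := by
    have hsq : energyInner Ω ν ((q.toFun - qh.toFun) + (1 / 2 : ℝ) • fluxSum ν uh qh)
        ((q.toFun - qh.toFun) + (1 / 2 : ℝ) • fluxSum ν uh qh) =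
        (1 / 2) ^ 2 * energyInner Ω ν (fluxSum ν uh qh) (fluxSum ν uh qh) := by
      rw [energyInner_add_smul_self hν he hE]
      linarith
    rw [energyNorm, hsq, Real.sqrt_mul (by positivity), Real.sqrt_sq (by norm_num), energyNorm]
  -- Uses `(E, ζh) - ½(E, ζh - ν∇ξh) = ½(E, Z)`.
  have herr : outputForm fO gDO gNO u q - (outputForm fO gDO gNO uh qh
        + 1 / 2 * energyInner Ω ν (fluxSum ν uh qh) (fluxDiff ν ξh ζh)) =
      energyInner Ω ν ((q.toFun - qh.toFun) + (1 / 2 : ℝ) • fluxSum ν uh qh)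
        (fluxSum ν ξh ζh) := by
    have hout := h.output_sub hν hN hr ha
    have hdiff : energyInner Ω ν (fluxSum ν uh qh) (fluxDiff ν ξh ζh) =
        energyInner Ω ν (fluxSum ν uh qh) ζh.toFun
          - energyInner Ω ν (fluxSum ν uh qh) (fun x => ν x • ξh.grad x) :=
      energyInner_sub_right hν hE ζh.memLp hX
    have hsum : energyInner Ω ν (fluxSum ν uh qh) (fluxSum ν ξh ζh) =
        energyInner Ω ν (fluxSum ν uh qh) ζh.toFun
          + energyInner Ω ν (fluxSum ν uh qh) (fun x => ν x • ξh.grad x) :=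
      energyInner_add_right hν hE ζh.memLp hX
    rw [energyInner_comm (b := fluxSum ν ξh ζh),
      energyInner_add_right hν hZ he (hE.const_smul (1 / 2 : ℝ)), energyInner_smul_right,
      energyInner_comm (a := fluxSum ν ξh ζh), energyInner_comm (a := fluxSum ν ξh ζh), hsum]
    linarith
  rw [herr, ← mul_assoc, ← hnorm]
  exact abs_energyInner_le hν hmid hZ

end

end PoissonBounds

open PoissonBounds in
theorem theorem1 {d : ℕ} (hd : d = 2 ∨ d = 3) (Ω ΓD ΓN : Set (Sp d))
    (hΩ : IsPolyhedralDomain Ω) (hΓ : IsBoundaryPartition Ω ΓD ΓN)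
    (ν : Sp d → ℝ) (hν : IsDiffusivity Ω ν)
    -- data of the primal problem
    (f gD gN : Sp d → ℝ) (hf : MemLp f 2 (volume.restrict Ω)) (hgD : ContinuousOn gD ΓD)
    (hgN : MemLp gN 2 ((surf d).restrict ΓN))
    -- data of the output functional
    (fO gDO gNO : Sp d → ℝ) (hfO : MemLp fO 2 (volume.restrict Ω)) (hgDO : ContinuousOn gDO ΓD)
    (hgNO : MemLp gNO 2 ((surf d).restrict ΓN))
    -- the exact solution
    (u : H1 Ω) (q : Hdiv Ω ΓD ΓN) (huq : IsWeakSolution ν f gD gN u q)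
    -- the reconstructions of the primal and of the adjoint problem
    (uh : H1 Ω) (qh : Hdiv Ω ΓD ΓN) (hprimal : IsReconstruction f gD gN uh qh)
    (ξh : H1 Ω) (ζh : Hdiv Ω ΓD ΓN)
    (hadjoint : IsReconstruction fO gDO (fun x => - gNO x) ξh ζh) :
    lowerBound ν fO gDO gNO uh qh ξh ζh ≤ outputForm fO gDO gNO u q ∧
    outputForm fO gDO gNO u q ≤ upperBound ν fO gDO gNO uh qh ξh ζh ∧
    boundAverage ν fO gDO gNO uh qh ξh ζh =
      outputForm fO gDO gNO uh qh
        + 1 / 2 * energyInner Ω ν (fluxSum ν uh qh) (fluxDiff ν ξh ζh) ∧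
    boundGap ν fO gDO gNO uh qh ξh ζh =
      energyNorm Ω ν (fluxSum ν uh qh) * energyNorm Ω ν (fluxSum ν ξh ζh) ∧
    |outputForm fO gDO gNO u q - boundAverage ν fO gDO gNO uh qh ξh ζh|
      ≤ 1 / 2 * boundGap ν fO gDO gNO uh qh ξh ζh := by
  have havg : boundAverage ν fO gDO gNO uh qh ξh ζh = outputForm fO gDO gNO uh qh
      + 1 / 2 * energyInner Ω ν (fluxSum ν uh qh) (fluxDiff ν ξh ζh) := by
    simp only [boundAverage, upperBound, lowerBound]
    ring
  have hgap : boundGap ν fO gDO gNO uh qh ξh ζh =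
      energyNorm Ω ν (fluxSum ν uh qh) * energyNorm Ω ν (fluxSum ν ξh ζh) := by
    simp only [boundGap, upperBound, lowerBound]
    ring
  have hmain := huq.abs_output_sub_le hν hΓ.subset_N hprimal hadjoint
  refine ⟨?_, ?_, havg, hgap, by rwa [havg, hgap]⟩
  · rw [lowerBound]
    linarith [(abs_le.1 hmain).1]
  · rw [upperBound]
    linarith [(abs_le.1 hmain).2]
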